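/- Let $R$ be a commutative ring with unit. All functors below are covariant functors on the category of commutative $R$-algebras. Write $\mathcal R$ for the functor of rings $\mathcal R(S)=S$. A functor of $\mathcal R$-modules $\mathbb M$ assigns to each $S$ an $S$-module $\mathbb M(S)$, with addition and scalar multiplication functorial in $S$. A functor of $\mathcal R$-algebras $\mathbb A$ is a functor of (associative, unital, not necessarily commutative) rings with a morphism of functors of rings $\mathcal R\to\mathbb A$ such that the image of $S$ in $\mathbb A(S)$ is central for every $S$. For an $R$-module $M$, let $\mathcal M$ be the quasi-coherent $\mathcal R$-module $\mathcal M(S)=M\otimes_R S$. A functor of $\mathcal R$-modules belongs to $\mathfrak F$ (is essentially free) if it is isomorphic, as a functor of $\mathcal R$-modules, to $\varprojlim_{\alpha\in P}\bigoplus_{\alpha}\mathcal R$ for some set $I$ and some set $P$ of subsets of $I$ closed under binary unions, the transition morphisms being the restrictions $\bigoplus_{\beta}\mathcal R\to\bigoplus_{\alpha}\mathcal R$ for $\alpha\subseteq\beta$. An $\mathbb A$-module structure on a functor of $\mathcal R$-modules $\mathbb M$ consists of left $\mathbb A(S)$-module structures on the groups $\mathbb M(S)$, functorial in $S$ and inducing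 the given $S$-module structures. Proposition. Let $\mathbb A$ be a functor of $\mathcal R$-algebras whose underlying functor of $\mathcal R$-modules belongs to $\mathfrak F$, let $M$ be an $R$-module, let $\mathcal M$ be endowed with an $\mathbb A$-module structure, and let $M'\subseteq M$ be an $R$-submodule. Then $\mathcal M'$ is a quasi-coherent $\mathbb A$-submodule of $\mathcal M$, that is, there is an $\mathbb A$-module structure on $\mathcal M'$ for which the natural morphism $\mathcal M'\to\mathcal M$ is a morphism of $\mathbb A$-modules, if and only if $M'$ is an $\mathbb A(R)$-submodule of $M=\mathcal M(R)$. -/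

import Mathlib

open CategoryTheory TensorProduct

universe u

/-- A functor of `𝓡`-modules: a covariant functor `𝕄` on commutative `R`-algebras such that every
`𝕄(S)` is an `S`-module, with addition and scalar multiplication functorial in `S`. -/
structure ModFunctor (R : Type u) [CommRing R] where
  obj : CommAlgCat.{u} R → Type u
  [addCommGroup : ∀ S, AddCommGroup (obj S)]
  [module : ∀ S : CommAlgCat.{u} R, Module S (obj S)]
  map : ∀ {S T : CommAlgCat.{u} R} (f : S ⟶ T), obj S →ₛₗ[(f.hom : S →+* T)] obj T
  map_id : ∀ (S : CommAlgCat.{u} R) (x : obj S), map (𝟙 S) x = x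
  map_comp : ∀ {S T U : CommAlgCat.{u} R} (f : S ⟶ T) (g : T ⟶ U) (x : obj S),
    map (f ≫ g) x = map g (map f x)

/-- A functor of `𝓡`-algebras: a functor `𝔸` from commutative `R`-algebras to (not necessarily
commutative) rings with a morphism of functors of rings `𝓡 → 𝔸` such that `S = 𝓡(S)` has
central image in `𝔸(S)`. -/
structure AlgFunctor (R : Type u) [CommRing R] where
  obj : CommAlgCat.{u} R → Type u
  [ring : ∀ S, Ring (obj S)]
  [algebra : ∀ S : CommAlgCat.{u} R, Algebra S (obj S)]
  map : ∀ {S T : CommAlgCat.{u} R}, (S ⟶ T) → (obj S →+* obj T)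
  map_algebraMap : ∀ {S T : CommAlgCat.{u} R} (f : S ⟶ T) (s : S),
    map f (algebraMap S (obj S) s) = algebraMap T (obj T) (f.hom s)
  map_id : ∀ (S : CommAlgCat.{u} R) (x : obj S), map (𝟙 S) x = x
  map_comp : ∀ {S T U : CommAlgCat.{u} R} (f : S ⟶ T) (g : T ⟶ U) (x : obj S),
    map (f ≫ g) x = map g (map f x)

attribute [instance] ModFunctor.addCommGroup ModFunctor.module AlgFunctor.ring AlgFunctor.algebra

noncomputable section

namespace ModFunctor

variable {R : Type u} [CommRing R]

/-- A morphism of functors of `𝓡`-modules. -/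
structure Hom (𝕄 𝕄' : ModFunctor R) where
  app : ∀ S : CommAlgCat.{u} R, 𝕄.obj S →ₗ[S] 𝕄'.obj S
  naturality : ∀ {S T : CommAlgCat.{u} R} (f : S ⟶ T) (x : 𝕄.obj S),
    app T (𝕄.map f x) = 𝕄'.map f (app S x)

/-- An isomorphism of functors of `𝓡`-modules. -/
structure Iso (𝕄 𝕄' : ModFunctor R) where
  app : ∀ S : CommAlgCat.{u} R, 𝕄.obj S ≃ₗ[S] 𝕄'.obj S
  naturality : ∀ {S T : CommAlgCat.{u} R} (f : S ⟶ T) (x : 𝕄.obj S),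
    app T (𝕄.map f x) = 𝕄'.map f (app S x)

/-- The quasi-coherent module associated with an `R`-module `M`: `𝓜(S) = S ⊗[R] M`. -/
def quasiCoherent (M : Type u) [AddCommGroup M] [Module R M] : ModFunctor R where
  obj S := S ⊗[R] M
  map {S T} f :=
    { toFun := LinearMap.rTensor M f.hom.toLinearMap
      map_add' := fun x y => map_add _ x y
      map_smul' := fun s x => by
        induction x using TensorProduct.induction_on with
        | zero => simp
        | tmul a m => simp [TensorProduct.smul_tmul']
        | add x y hx hy => rw [smul_add, map_add, hx, hy, map_add, smul_add] }
  map_id S x := by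
    induction x using TensorProduct.induction_on with
    | zero => exact map_zero _
    | tmul a m => rfl
    | add x y hx hy => rw [map_add, hx, hy]
  map_comp f g x := by
    induction x using TensorProduct.induction_on with
    | zero => simp
    | tmul a m => simp
    | add x y hx hy => simp only [map_add, hx, hy]

/-- The morphism `𝓜' → 𝓜` induced by the inclusion of an `R`-submodule `M' ⊆ M`. It need not be
injective on `S`-points. -/
def inclusion {M : Type u} [AddCommGroup M] [Module R M] (M' : Submodule R M) :
    Hom (quasiCoherent (R := R) M') (quasiCoherent (R := R) M) where
  app S := M'.subtype.baseChange S
  naturality {S T} f x := by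
    change M'.subtype.baseChange T (LinearMap.rTensor M' f.hom.toLinearMap x) =
      LinearMap.rTensor M f.hom.toLinearMap (M'.subtype.baseChange S x)
    induction x using TensorProduct.induction_on with
    | zero => simp
    | tmul a m => simp
    | add x y hx hy => simp only [map_add, hx, hy]

/-- The `S`-points of the inverse limit of the `𝓡^(α)`, `α ∈ P`: families `(xₐ)` with
`xₐ ∈ ⨁_{α} S`, such that `xₐ` is the restriction of `x_b` to `a` whenever `a ⊆ b`. -/
def freeLimPoints {I : Type u} (P : Set (Set I)) (S : Type u) [CommRing S] :
    Submodule S (∀ α : P, (α : Set I) →₀ S) where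
  carrier := {x | ∀ (α β : P) (h : (α : Set I) ⊆ (β : Set I)) (i : (α : Set I)),
    x α i = x β ⟨i, h i.2⟩}
  add_mem' hx hy α β h i := by simp [hx α β h i, hy α β h i]
  zero_mem' α β h i := by simp
  smul_mem' s x hx α β h i := by simp [hx α β h i]

/-- The inverse limit of the functors `𝓡^(α) = ⨁_α 𝓡`, over `α ∈ P`, along the restriction
morphisms `𝓡^(β) → 𝓡^(α)` for `α ⊆ β`. -/
def freeLim {I : Type u} (P : Set (Set I)) : ModFunctor R where
  obj S := freeLimPoints P S
  map {S T} f :=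
    { toFun := fun x => ⟨fun α => (x.1 α).mapRange f.hom (map_zero _), fun α β h i => by
        simp [x.2 α β h i]⟩
      map_add' := fun x y => by ext; simp
      map_smul' := fun s x => by ext; simp }
  map_id S x := by ext; rfl
  map_comp f g x := by ext; rfl

/-- Membership in `𝔉`. -/
def EssentiallyFree (𝕄 : ModFunctor R) : Prop :=
  ∃ (I : Type u) (P : Set (Set I)), (∀ α ∈ P, ∀ β ∈ P, α ∪ β ∈ P) ∧
    Nonempty (Iso 𝕄 (freeLim P))

end ModFunctor

namespace AlgFunctor

variable {R : Type u} [CommRing R]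

/-- The functor of `𝓡`-modules underlying a functor of `𝓡`-algebras. -/
def toModFunctor (A : AlgFunctor R) : ModFunctor R where
  obj := A.obj
  map {S T} f :=
    { toFun := A.map f
      map_add' := fun x y => map_add _ x y
      map_smul' := fun s x => by
        rw [Algebra.smul_def, map_mul, A.map_algebraMap, Algebra.smul_def]; rfl }
  map_id := A.map_id
  map_comp := A.map_comp

/-- A structure of (left) `𝔸`-module on a functor of `𝓡`-modules `𝕄`: functorial `𝔸(S)`-module
structures on the groups `𝕄(S)` that induce the given `S`-module structures. -/
structure ModuleStr (A : AlgFunctor R) (𝕄 : ModFunctor R) where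
  module : ∀ S, Module (A.obj S) (𝕄.obj S)
  isScalarTower : ∀ S : CommAlgCat.{u} R, IsScalarTower S (A.obj S) (𝕄.obj S)
  map_smul : ∀ {S T : CommAlgCat.{u} R} (f : S ⟶ T) (a : A.obj S) (x : 𝕄.obj S),
    𝕄.map f (a • x) = A.map f a • 𝕄.map f x

/-- A morphism `φ` of functors of `𝓡`-modules is a morphism of `𝔸`-modules. -/
def IsModuleHom {A : AlgFunctor R} {𝕄 𝕄' : ModFunctor R} (s : A.ModuleStr 𝕄) (t : A.ModuleStr 𝕄')
    (φ : ModFunctor.Hom 𝕄 𝕄') : Prop :=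
  letI := s.module
  letI := t.module
  ∀ (S : CommAlgCat.{u} R) (a : A.obj S) (x : 𝕄.obj S), φ.app S (a • x) = a • φ.app S x

variable {A : AlgFunctor R} {M : Type u} [AddCommGroup M] [Module R M]

/-- `𝓜'` is a quasi-coherent `𝔸`-submodule of the `𝔸`-module `𝓜`: there is an `𝔸`-module structure
on `𝓜'` for which `𝓜' → 𝓜` is a morphism of `𝔸`-modules. -/
def IsQuasiCoherentSubmodule (s : A.ModuleStr (ModFunctor.quasiCoherent (R := R) M))
    (M' : Submodule R M) : Prop :=
  ∃ t : A.ModuleStr (ModFunctor.quasiCoherent (R := R) M'),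
    IsModuleHom t s (ModFunctor.inclusion M')

/-- The `𝔸(R)`-module structure on `M = 𝓜(R)` (identified through `R ⊗[R] M ≃ M`) given by an
`𝔸`-module structure on `𝓜`. -/
abbrev baseModule (s : A.ModuleStr (ModFunctor.quasiCoherent (R := R) M)) :
    Module (A.obj (CommAlgCat.of R R)) M :=
  letI : Module (A.obj (CommAlgCat.of R R)) (R ⊗[R] M) := s.module (CommAlgCat.of R R)
  (TensorProduct.lid R M).symm.toAddEquiv.module (A.obj (CommAlgCat.of R R))

/-- `M'` is an `𝔸(R)`-submodule of `M`. -/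
def IsBaseSubmodule (s : A.ModuleStr (ModFunctor.quasiCoherent (R := R) M))
    (M' : Submodule R M) : Prop :=
  letI := baseModule s
  ∃ N : Submodule (A.obj (CommAlgCat.of R R)) M, (N : Set M) = M'

end AlgFunctor

end

/-! Evaluating at `R` gives one direction. For the converse, identify `𝔸(S)` with the functions `I →
S` whose support lies in a family of sets independent of `S`. The crux is that a natural family of
`T`-linear maps `φ : 𝔸(T) → T ⊗ N`, for `T` over `S`, satisfies `φ(a) = ∑ᵢ aᵢ φ(eᵢ)`, with only
finitely many nonzero `φ(eᵢ)` for `i` in an admissible support (`exists_coefficients`,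
`app_eq_finsum`). To see this, apply `φ` to a generic element `∑ xᵢ eᵢ` over the square-zero
extension `S ⊕ ⨁ S xᵢ`: its image involves finitely many `xᵢ`, and the specialization `xᵢ ↦ aᵢ ε` in
`T[ε]` yields `ε φ(a)`.

Applied to orbit maps, this forces the action on `𝓜'` to be `a (1 ⊗ m) = ∑ᵢ aᵢ ⊗ eᵢ m`, which makes
sense because `eᵢ m ∈ M'`. Since `T ⊗ M' → T ⊗ M` may fail to be injective, the module axioms cannot
be read off from `𝓜` over every `T`. They are inherited over `R`, where the map is injective. The
unit law spreads by naturality; associativity spreads because its defect is natural and linear in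
each algebra variable, hence vanishes once it does on basis vectors, which come from `R`
(`mul_of_base`). -/

noncomputable section

/-! ### Coordinates on essentially free functors. -/

namespace ModFunctor

variable {R : Type u} [CommRing R]

/-- Coordinates on a functor of modules `𝕄`: an identification of `𝕄(S)` with the module of those
functions `I → S` whose support belongs to a fixed family of subsets of `I`. -/
structure Coordinates (𝕄 : ModFunctor R) where
  I : Type u
  supports : Set (Set I)
  singleton_mem : ∀ i, {i} ∈ supports
  mono : ∀ {J K : Set I}, J ∈ supports → K ⊆ J → K ∈ supports
  coord : ∀ S : CommAlgCat.{u} R, 𝕄.obj S →ₗ[S] (I → S)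
  coord_injective : ∀ S, Function.Injective (coord S)
  support_mem : ∀ S (x : 𝕄.obj S), Function.support (coord S x) ∈ supports
  exists_coord_eq : ∀ (S : CommAlgCat.{u} R) (h : I → S), Function.support h ∈ supports →
    ∃ x, coord S x = h
  coord_map : ∀ {S T : CommAlgCat.{u} R} (f : S ⟶ T) (x : 𝕄.obj S) (i : I),
    coord T (𝕄.map f x) i = f.hom (coord S x i)

/-- A compatible family is a single function on `⋃₀ P` whose restriction to each `α ∈ P` has finite
support. -/
theorem EssentiallyFree.nonempty_coordinates {𝕄 : ModFunctor R} (h : 𝕄.EssentiallyFree) :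
    Nonempty 𝕄.Coordinates := by
  classical
  obtain ⟨I, P, hP, ⟨e⟩⟩ := h
  have hmem : ∀ i : ↥(⋃₀ P), ∃ α : P, (i : I) ∈ (α : Set I) := fun i => by
    obtain ⟨α, hα, hi⟩ := i.2
    exact ⟨⟨α, hα⟩, hi⟩
  choose p hp using hmem
  have hsub : ∀ α : P, ∀ i ∈ (α : Set I), i ∈ ⋃₀ P := fun α i hi => ⟨α, α.2, hi⟩
  have key : ∀ (S : CommAlgCat.{u} R) (x : freeLimPoints P S) (α : P) (i : (α : Set I)),
      x.1 α i = x.1 (p ⟨i, hsub α i i.2⟩) ⟨i, hp ⟨i, hsub α i i.2⟩⟩ := by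
    intro S x α i
    -- Closure under unions makes the value at `i` independent of the chosen member of `P`: compare
    -- both inside their union.
    let γ : P := ⟨α ∪ p ⟨i, hsub α i i.2⟩, hP _ α.2 _ (p ⟨i, hsub α i i.2⟩).2⟩
    rw [x.2 α γ Set.subset_union_left i, x.2 _ γ Set.subset_union_right]
  let c : ∀ S : CommAlgCat.{u} R, freeLimPoints P S →ₗ[S] (↥(⋃₀ P) → S) := fun S =>
    { toFun := fun x i => x.1 (p i) ⟨i, hp i⟩
      map_add' := fun x y => by ext; simp
      map_smul' := fun s x => by ext; simp }
  have hc : ∀ (S : CommAlgCat.{u} R) (x : freeLimPoints P S) (α : P) (i : (α : Set I)),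
      x.1 α i = c S x ⟨i, hsub α i i.2⟩ := key
  let E : ∀ S : CommAlgCat.{u} R, 𝕄.obj S ≃ₗ[S] freeLimPoints P S := e.app
  refine ⟨{
    I := ↥(⋃₀ P)
    supports := {J | ∀ α : P, {i : (α : Set I) | ⟨i, hsub α i i.2⟩ ∈ J}.Finite}
    singleton_mem := fun i α => ?_
    mono := fun hJ hK α => (hJ α).subset fun i hi => hK hi
    coord := fun S => c S ∘ₗ (E S).toLinearMap
    coord_injective := fun S => ?_
    support_mem := fun S x α => ?_
    exists_coord_eq := fun S h hh => ?_
    coord_map := fun {S T} f x i => ?_ }⟩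
  · refine Set.Subsingleton.finite fun a ha b hb => ?_
    simp only [Set.mem_ofPred_eq, Set.mem_singleton_iff] at ha hb
    exact Subtype.ext (Subtype.mk.inj (ha.trans hb.symm))
  · rw [LinearMap.coe_comp]
    refine Function.Injective.comp (fun x y hxy => ?_) (E S).injective
    refine Subtype.ext (funext fun α => Finsupp.ext fun i => ?_)
    rw [hc, hc, hxy]
  · refine (Finsupp.hasFiniteSupport ((E S x).1 α)).subset fun i hi => ?_
    have hi' : c S (E S x) ⟨i, hsub α i i.2⟩ ≠ 0 := hi
    rwa [← hc] at hi'
  · let y : freeLimPoints P S :=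
      ⟨fun α => Finsupp.ofSupportFinite (fun i => h ⟨i, hsub α i i.2⟩) (hh α),
        fun α β _ i => rfl⟩
    refine ⟨(E S).symm y, ?_⟩
    rw [LinearMap.comp_apply, LinearEquiv.coe_coe, LinearEquiv.apply_symm_apply]
    rfl
  · change c T (e.app T (𝕄.map f x)) i = _
    rw [e.naturality]
    rfl

namespace Coordinates

variable {𝕄 : ModFunctor R} (K : 𝕄.Coordinates)

/-- The element of `𝕄(S)` with prescribed coordinates. -/
def ofCoord (S : CommAlgCat.{u} R) (h : K.I → S) (hh : Function.support h ∈ K.supports) : 𝕄.obj S :=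
  (K.exists_coord_eq S h hh).choose

@[simp]
theorem coord_ofCoord (S : CommAlgCat.{u} R) (h : K.I → S) (hh : Function.support h ∈ K.supports) :
    K.coord S (K.ofCoord S h hh) = h :=
  (K.exists_coord_eq S h hh).choose_spec

open Classical in
/-- The element of `𝕄(S)` with a single nonzero coordinate, equal to `1`. -/
def basisVec (S : CommAlgCat.{u} R) (i : K.I) : 𝕄.obj S :=
  K.ofCoord S (Pi.single i 1) (K.mono (K.singleton_mem i) Pi.support_single_subset)

open Classical in
@[simp]
theorem coord_basisVec (S : CommAlgCat.{u} R) (i : K.I) :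
    K.coord S (K.basisVec S i) = Pi.single i 1 :=
  K.coord_ofCoord ..

theorem map_basisVec {S T : CommAlgCat.{u} R} (f : S ⟶ T) (i : K.I) :
    𝕄.map f (K.basisVec S i) = K.basisVec T i := by
  classical
  refine K.coord_injective T (funext fun j => ?_)
  rw [K.coord_map, coord_basisVec, coord_basisVec]
  by_cases h : j = i
  · subst h; simp
  · simp [h]

end Coordinates

end ModFunctor

/-! ### Specializing a square-zero extension to dual numbers. -/

namespace TrivSqZeroExt

variable {R : Type u} [CommRing R] {S T : Type u} [CommRing S] [CommRing T] [Algebra R S]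
  [Algebra R T] {I : Type u}

/-- The linear map `⨁ᵢ S → T` over `f : S → T` sending the `i`-th basis vector to `a i`. -/
def evalCoeff (f : S →ₐ[R] T) (a : I → T) : (I →₀ S) →ₗ[R] T :=
  Finsupp.lsum R fun i => LinearMap.mulRight R (a i) ∘ₗ f.toLinearMap

theorem evalCoeff_apply (f : S →ₐ[R] T) (a : I → T) (v : I →₀ S) :
    evalCoeff f a v = v.sum fun i s => f s * a i :=
  rfl

theorem evalCoeff_smul (f : S →ₐ[R] T) (a : I → T) (s : S) (v : I →₀ S) :
    evalCoeff f a (s • v) = f s * evalCoeff f a v := by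
  rw [evalCoeff_apply, evalCoeff_apply, Finsupp.sum_smul_index (by simp), Finsupp.mul_sum]
  simp [mul_assoc]

/-- The algebra morphism `S ⊕ ⨁ᵢ S xᵢ → T[ε]` over `f : S → T` sending `xᵢ` to `aᵢ ε`. -/
def specialize (f : S →ₐ[R] T) (a : I → T) :
    TrivSqZeroExt S (I →₀ S) →ₐ[R] TrivSqZeroExt T T :=
  TrivSqZeroExt.lift ((TrivSqZeroExt.inlAlgHom R T T).comp f)
    (((TrivSqZeroExt.inrHom T T).restrictScalars R) ∘ₗ evalCoeff f a)
    (fun x y => by simp)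
    (fun s x => by ext <;> simp [evalCoeff_smul, mul_comm])
    (fun s x => by ext <;> simp [evalCoeff_smul, mul_comm])

theorem snd_specialize (f : S →ₐ[R] T) (a : I → T) (z : TrivSqZeroExt S (I →₀ S)) :
    (specialize f a z).snd = evalCoeff f a z.snd := by
  simp [specialize, TrivSqZeroExt.lift_def]

theorem specialize_inl (f : S →ₐ[R] T) (a : I → T) (s : S) :
    specialize f a (inl s) = inl (f s) := by
  simp [specialize]

theorem specialize_inr (f : S →ₐ[R] T) (a : I → T) (v : I →₀ S) :
    specialize f a (inr v) = inr (evalCoeff f a v) := by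
  simp [specialize]

end TrivSqZeroExt

/-! ### Natural families of linear maps are determined by finitely many coefficients. -/

namespace ModFunctor

variable {R : Type u} [CommRing R]

/-- The base change morphism `S ⊗ N → T ⊗ N`. -/
abbrev tensorMap {S T : CommAlgCat.{u} R} (N : Type u) [AddCommGroup N] [Module R N] (f : S ⟶ T) :
    S ⊗[R] N →ₗ[R] T ⊗[R] N :=
  LinearMap.rTensor N f.hom.toLinearMap

/-- For `S` fixed, a natural family of linear maps
`𝕄(T) → T ⊗ N` indexed by the `S`-algebras `T`. -/
structure RelHom (𝕄 : ModFunctor R) (S : CommAlgCat.{u} R) (N : Type u) [AddCommGroup N]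
    [Module R N] where
  app : ∀ {T : CommAlgCat.{u} R} (_ : S ⟶ T), 𝕄.obj T →ₗ[T] T ⊗[R] N
  naturality : ∀ {T U : CommAlgCat.{u} R} (f : S ⟶ T) (g : T ⟶ U) (x : 𝕄.obj T),
    tensorMap N g (app f x) = app (f ≫ g) (𝕄.map g x)

namespace Coordinates

variable {𝕄 : ModFunctor R} (K : 𝕄.Coordinates) {S : CommAlgCat.{u} R} {N : Type u}
  [AddCommGroup N] [Module R N]

/-- A tensor is a finite sum of terms `z ⊗ m`, and each `z` involves finitely many `xᵢ`. Collecting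
the coefficients of `xᵢ` gives `n`, which serves all `f` and `a` at once. -/
theorem exists_finsupp_rTensor_evalCoeff (I : Type u)
    (w : TrivSqZeroExt S (I →₀ S) ⊗[R] N) :
    ∃ n : I →₀ S ⊗[R] N, ∀ (T : CommAlgCat.{u} R) (f : S ⟶ T) (a : I → T),
      LinearMap.rTensor N (TrivSqZeroExt.evalCoeff f.hom a ∘ₗ
        (TrivSqZeroExt.sndHom S (I →₀ S)).restrictScalars R) w =
        n.sum fun i y => a i • tensorMap N f y := by
  induction w using TensorProduct.induction_on with
  | zero => exact ⟨0, fun T f a => by simp⟩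
  | tmul z m =>
    refine ⟨z.snd.mapRange (fun s => s ⊗ₜ m) (by simp), fun T f a => ?_⟩
    rw [Finsupp.sum_mapRange_index (by simp), LinearMap.rTensor_tmul]
    simp [TrivSqZeroExt.evalCoeff_apply, Finsupp.sum, TensorProduct.sum_tmul,
      TensorProduct.smul_tmul', mul_comm]
  | add x y hx hy =>
    obtain ⟨n, hn⟩ := hx
    obtain ⟨n', hn'⟩ := hy
    refine ⟨n + n', fun T f a => ?_⟩
    classical
    rw [map_add, hn, hn', Finsupp.sum_add_index' (by simp) (by simp)]

/-- By the hypothesis on coordinates, `z` and `x` become `z = ε x` in `𝕄(T')`; naturality and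
linearity of `φ` do the rest. -/
theorem tensorMap_app_eq_smul (φ : RelHom 𝕄 S N) {S' T T' : CommAlgCat.{u} R} {ι : S ⟶ S'}
    {g : S' ⟶ T'} {f : S ⟶ T} {j : T ⟶ T'} (h : ι ≫ g = f ≫ j) (ε : T') (z : 𝕄.obj S')
    (x : 𝕄.obj T) (hz : ∀ i, g.hom (K.coord S' z i) = ε * j.hom (K.coord T x i)) :
    tensorMap N g (φ.app ι z) = ε • tensorMap N j (φ.app f x) := by
  have hgen : 𝕄.map g z = ε • 𝕄.map j x := by
    refine K.coord_injective T' (funext fun i => ?_)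
    rw [K.coord_map, map_smul, Pi.smul_apply, K.coord_map, hz, smul_eq_mul]
  rw [φ.naturality, φ.naturality, hgen, map_smul, h]

/-- On elements supported in a fixed admissible set `J`, a natural family of linear maps
`𝕄(T) → T ⊗ N` is given by finitely many coefficients. -/
theorem exists_coefficients (φ : RelHom 𝕄 S N) {J : Set K.I} (hJ : J ∈ K.supports) :
    ∃ n : K.I →₀ S ⊗[R] N, (∀ i ∈ J, φ.app (𝟙 S) (K.basisVec S i) = n i) ∧
      ∀ {T : CommAlgCat.{u} R} (f : S ⟶ T) (x : 𝕄.obj T), Function.support (K.coord T x) ⊆ J →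
        φ.app f x = n.sum fun i y => K.coord T x i • tensorMap N f y := by
  classical
  let S' : CommAlgCat.{u} R := CommAlgCat.of R (TrivSqZeroExt S (K.I →₀ S))
  let ι : S ⟶ S' := CommAlgCat.ofHom (TrivSqZeroExt.inlAlgHom R S (K.I →₀ S))
  -- The generic element; it is cut off outside `J` so that its support is admissible.
  let ξ : K.I → S' := fun i =>
    if i ∈ J then (TrivSqZeroExt.inr (Finsupp.single i 1) : TrivSqZeroExt S (K.I →₀ S)) else 0
  have hξ : Function.support ξ ∈ K.supports := K.mono hJ fun i hi => by
    by_contra h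
    exact hi (if_neg h)
  obtain ⟨n, hn⟩ := exists_finsupp_rTensor_evalCoeff (N := N) K.I (φ.app ι (K.ofCoord S' ξ hξ))
  have main : ∀ {T : CommAlgCat.{u} R} (f : S ⟶ T) (x : 𝕄.obj T),
      Function.support (K.coord T x) ⊆ J →
        φ.app f x = n.sum fun i y => K.coord T x i • tensorMap N f y := by
    intro T f x hx
    rw [← hn]
    let a := K.coord T x
    let T' : CommAlgCat.{u} R := CommAlgCat.of R (TrivSqZeroExt T T)
    let j : T ⟶ T' := CommAlgCat.ofHom (TrivSqZeroExt.inlAlgHom R T T)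
    let g : S' ⟶ T' := CommAlgCat.ofHom (TrivSqZeroExt.specialize f.hom a)
    let ε : T' := (TrivSqZeroExt.inr 1 : TrivSqZeroExt T T)
    have hfg : ι ≫ g = f ≫ j := by
      refine CommAlgCat.hom_ext (AlgHom.ext fun s => ?_)
      exact TrivSqZeroExt.specialize_inl f.hom a s
    have h1 : tensorMap N g (φ.app ι (K.ofCoord S' ξ hξ)) = ε • tensorMap N j (φ.app f x) := by
      refine K.tensorMap_app_eq_smul φ hfg ε _ x fun i => ?_
      rw [coord_ofCoord]
      by_cases hi : i ∈ J
      · have h1 : ξ i = (TrivSqZeroExt.inr (Finsupp.single i 1) : TrivSqZeroExt S (K.I →₀ S)) :=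
          if_pos hi
        rw [h1]
        refine (TrivSqZeroExt.specialize_inr f.hom a _).trans ?_
        change _ = (TrivSqZeroExt.inr 1 : TrivSqZeroExt T T) * TrivSqZeroExt.inl (a i)
        rw [TrivSqZeroExt.inr_mul_inl, TrivSqZeroExt.evalCoeff_apply,
          Finsupp.sum_single_index (by simp)]
        simp
      · have h1 : ξ i = 0 := if_neg hi
        have h2 : K.coord T x i = 0 := by
          by_contra h
          exact hi (hx h)
        rw [h1, h2, map_zero, map_zero, mul_zero]
    -- Taking the coefficient of `ε` recovers `φ(x)` from `ε φ(x)`.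
    let p : TrivSqZeroExt T T →ₗ[R] T := (TrivSqZeroExt.sndHom T T).restrictScalars R
    have h2 : ∀ y : T ⊗[R] N, LinearMap.rTensor N p (ε • tensorMap N j y) = y := by
      intro y
      induction y using TensorProduct.induction_on with
      | zero => simp
      | tmul t m =>
        change (TrivSqZeroExt.snd ((TrivSqZeroExt.inr 1 : TrivSqZeroExt T T) *
          TrivSqZeroExt.inl t)) ⊗ₜ[R] m = _
        simp
      | add y z hy hz => rw [map_add, smul_add, map_add, hy, hz]
    rw [← h2 (φ.app f x), ← h1]
    refine (LinearMap.rTensor_comp_apply N p g.hom.toLinearMap _).symm.trans ?_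
    congr 2
    ext z
    exact TrivSqZeroExt.snd_specialize f.hom a z
  refine ⟨n, fun i hi => ?_, main⟩
  -- Evaluating the formula at `eᵢ` identifies the coefficients with indices in `J`.
  rw [main (𝟙 S) _ (by
    rw [coord_basisVec]
    exact Pi.support_single_subset.trans (Set.singleton_subset_iff.2 hi)), coord_basisVec]
  have hid : ∀ y : S ⊗[R] N, tensorMap N (𝟙 S) y = y := fun y =>
    LinearMap.rTensor_id_apply N S y
  simp only [hid, Finsupp.sum]
  rw [Finset.sum_eq_single i]
  · simp
  · intro k _ hk
    simp [hk]
  · intro h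
    simp [Finsupp.notMem_support_iff.1 h]

theorem finite_setOf_app_basisVec_ne_zero (φ : RelHom 𝕄 S N) (J : Set K.I)
    (hJ : J ∈ K.supports) : {i ∈ J | φ.app (𝟙 S) (K.basisVec S i) ≠ 0}.Finite := by
  obtain ⟨n, hn, -⟩ := K.exists_coefficients φ hJ
  refine n.hasFiniteSupport.subset fun i hi => ?_
  have := hi.2
  rwa [hn i hi.1] at this

/-- Take `J` to be the support of `x`. It is admissible over every algebra, so coefficients found
over `S` apply to an `x` over `T`. -/
theorem app_eq_finsum (φ : RelHom 𝕄 S N) {T : CommAlgCat.{u} R} (f : S ⟶ T) (x : 𝕄.obj T) :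
    φ.app f x =
      ∑ᶠ i, K.coord T x i • tensorMap N f (φ.app (𝟙 S) (K.basisVec S i)) := by
  obtain ⟨n, hn, h⟩ := K.exists_coefficients φ (K.support_mem T x)
  rw [h f x subset_rfl, Finsupp.sum, finsum_eq_sum_of_support_subset (s := n.support)]
  · refine Finset.sum_congr rfl fun i _ => ?_
    by_cases hi : K.coord T x i = 0
    · rw [hi, zero_smul, zero_smul]
    · rw [hn i hi]
  · intro i hi
    rw [Finset.mem_coe, Finsupp.mem_support_iff]
    intro h0
    refine hi ?_
    by_cases hi : K.coord T x i = 0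
    · simp only [hi, zero_smul]
    · simp only [hn i hi, h0, map_zero, smul_zero]

/-- A natural family of linear maps vanishes if it vanishes on the basis vectors. -/
theorem app_eq_zero (φ : RelHom 𝕄 S N) (h : ∀ i, φ.app (𝟙 S) (K.basisVec S i) = 0)
    {T : CommAlgCat.{u} R} (f : S ⟶ T) (x : 𝕄.obj T) : φ.app f x = 0 := by
  rw [K.app_eq_finsum φ]
  simp [h]

end Coordinates

end ModFunctor

end

noncomputable section

/-! ### Actions by natural bilinear maps, and verifying the module axioms over the base. -/

namespace AlgFunctor

open ModFunctor

variable {R : Type u} [CommRing R] {A : AlgFunctor R}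

/-- The action of `𝔸(S)` on `𝕄(S)` by endomorphisms, for an `𝔸`-module `𝕄`. -/
def ModuleStr.toEnd {𝕄 : ModFunctor R} (s : A.ModuleStr 𝕄) (S : CommAlgCat.{u} R) :
    A.obj S →ₐ[S] Module.End S (𝕄.obj S) :=
  letI := s.module S
  haveI := s.isScalarTower S
  haveI : SMulCommClass (A.obj S) S (𝕄.obj S) := IsScalarTower.to_smulCommClass'
  Algebra.lsmul S S (𝕄.obj S)

/-- Natural bilinear maps `𝔸(T) × (T ⊗ N) → T ⊗ N`, not required to be associative or unital. -/
structure TensorAction (A : AlgFunctor R) (N : Type u) [AddCommGroup N] [Module R N] where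
  app : ∀ T : CommAlgCat.{u} R, A.obj T →ₗ[T] Module.End T (T ⊗[R] N)
  naturality : ∀ {T U : CommAlgCat.{u} R} (g : T ⟶ U) (a : A.obj T) (y : T ⊗[R] N),
    tensorMap N g (app T a y) = app U (A.map g a) (tensorMap N g y)

/-- The natural bilinear maps underlying an `𝔸`-module structure on `𝓝`. -/
def ModuleStr.toTensorAction {N : Type u} [AddCommGroup N] [Module R N]
    (s : A.ModuleStr (quasiCoherent (R := R) N)) : A.TensorAction N where
  app T := (s.toEnd T).toLinearMap
  naturality g a y := s.map_smul g a y

theorem ModuleStr.toTensorAction_one {N : Type u} [AddCommGroup N] [Module R N]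
    (s : A.ModuleStr (quasiCoherent (R := R) N)) (T : CommAlgCat.{u} R) :
    s.toTensorAction.app T 1 = 1 :=
  map_one (s.toEnd T)

theorem ModuleStr.toTensorAction_mul {N : Type u} [AddCommGroup N] [Module R N]
    (s : A.ModuleStr (quasiCoherent (R := R) N)) (T : CommAlgCat.{u} R) (a b : A.obj T) :
    s.toTensorAction.app T (a * b) = s.toTensorAction.app T a * s.toTensorAction.app T b :=
  map_mul (s.toEnd T) a b

/-- Associative and unital natural bilinear maps define an `𝔸`-module structure on `𝓝`. -/
def TensorAction.toModuleStr {N : Type u} [AddCommGroup N] [Module R N] (τ : A.TensorAction N)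
    (one : ∀ T, τ.app T 1 = 1) (mul : ∀ T a b, τ.app T (a * b) = τ.app T a * τ.app T b) :
    A.ModuleStr (quasiCoherent (R := R) N) where
  module S :=
    { smul := fun a y => τ.app S a y
      one_smul := fun y => LinearMap.congr_fun (one S) y
      mul_smul := fun a b y => LinearMap.congr_fun (mul S a b) y
      smul_zero := fun a => map_zero (τ.app S a)
      smul_add := fun a => map_add (τ.app S a)
      add_smul := fun a b y => LinearMap.congr_fun (map_add (τ.app S) a b) y
      zero_smul := fun y => LinearMap.congr_fun (map_zero (τ.app S)) y }
  isScalarTower S :=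
    @IsScalarTower.mk _ _ _ _ (_) _ fun t a y =>
      LinearMap.congr_fun (map_smul (τ.app S) t a) y
  map_smul g a y := τ.naturality g a y

section Tensor

variable {N : Type u} [AddCommGroup N] [Module R N]

theorem tensorMap_smul {S T : CommAlgCat.{u} R} (f : S ⟶ T) (s : S) (y : S ⊗[R] N) :
    tensorMap N f (s • y) = f.hom s • tensorMap N f y :=
  ((quasiCoherent (R := R) N).map f).map_smulₛₗ s y

theorem tensorMap_comp {S T U : CommAlgCat.{u} R} (f : S ⟶ T) (g : T ⟶ U) (y : S ⊗[R] N) :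
    tensorMap N (f ≫ g) y = tensorMap N g (tensorMap N f y) :=
  (quasiCoherent (R := R) N).map_comp f g y

theorem tensorMap_id {S : CommAlgCat.{u} R} (y : S ⊗[R] N) : tensorMap N (𝟙 S) y = y :=
  (quasiCoherent (R := R) N).map_id S y

theorem tensorMap_one_tmul {S T : CommAlgCat.{u} R} (f : S ⟶ T) (m : N) :
    tensorMap N f ((1 : S) ⊗ₜ m) = (1 : T) ⊗ₜ m := by
  simp

/-- The structure morphism `R → T`. -/
abbrev fromBase (T : CommAlgCat.{u} R) : CommAlgCat.of R R ⟶ T :=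
  CommAlgCat.ofHom (Algebra.ofId R T)

/-- The orbit map `a ↦ a y` of a fixed element `y`. -/
def TensorAction.orbit (τ : A.TensorAction N) {S : CommAlgCat.{u} R} (y : S ⊗[R] N) :
    RelHom A.toModFunctor S N where
  app {T} f := (LinearMap.applyₗ (tensorMap N f y)).comp (τ.app T)
  naturality f g a := by
    refine (τ.naturality g a _).trans ?_
    rw [← tensorMap_comp]
    rfl

/-- The defect of associativity `a ↦ (a b) y - a (b y)`. -/
def TensorAction.assocDefectLeft (τ : A.TensorAction N) {S : CommAlgCat.{u} R} (b : A.obj S)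
    (y : S ⊗[R] N) : RelHom A.toModFunctor S N where
  app {T} f :=
    (LinearMap.applyₗ (tensorMap N f y)).comp
      (τ.app T ∘ₗ LinearMap.mulRight T (A.map f b)) -
    (LinearMap.applyₗ (τ.app T (A.map f b) (tensorMap N f y))).comp (τ.app T)
  naturality {T U} f g (a : A.obj T) := by
    change tensorMap N g (τ.app T (a * A.map f b) (tensorMap N f y) -
      τ.app T a (τ.app T (A.map f b) (tensorMap N f y))) =
      τ.app U (A.map g a * A.map (f ≫ g) b) (tensorMap N (f ≫ g) y) -
      τ.app U (A.map g a) (τ.app U (A.map (f ≫ g) b) (tensorMap N (f ≫ g) y))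
    rw [map_sub, τ.naturality, τ.naturality, τ.naturality, tensorMap_comp, A.map_comp, map_mul]

/-- The defect of associativity `b ↦ (a b) y - a (b y)`. -/
def TensorAction.assocDefectRight (τ : A.TensorAction N) {S : CommAlgCat.{u} R} (a : A.obj S)
    (y : S ⊗[R] N) : RelHom A.toModFunctor S N where
  app {T} f :=
    (LinearMap.applyₗ (tensorMap N f y)).comp
      (τ.app T ∘ₗ LinearMap.mulLeft T (A.map f a)) -
    (τ.app T (A.map f a)).comp ((LinearMap.applyₗ (tensorMap N f y)).comp (τ.app T))
  naturality {T U} f g (b : A.obj T) := by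
    change tensorMap N g (τ.app T (A.map f a * b) (tensorMap N f y) -
      τ.app T (A.map f a) (τ.app T b (tensorMap N f y))) =
      τ.app U (A.map (f ≫ g) a * A.map g b) (tensorMap N (f ≫ g) y) -
      τ.app U (A.map (f ≫ g) a) (τ.app U (A.map g b) (tensorMap N (f ≫ g) y))
    rw [map_sub, τ.naturality, τ.naturality, τ.naturality, tensorMap_comp, A.map_comp, map_mul]

theorem end_ext {T : CommAlgCat.{u} R} {P : Type u} [AddCommGroup P] [Module T P]
    {f g : T ⊗[R] N →ₗ[T] P} (h : ∀ m : N, f (1 ⊗ₜ m) = g (1 ⊗ₜ m)) : f = g := by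
  refine LinearMap.ext fun y => ?_
  induction y using TensorProduct.induction_on with
  | zero => simp
  | tmul t m =>
    have : t ⊗ₜ[R] m = t • ((1 : T) ⊗ₜ[R] m) := by simp [TensorProduct.smul_tmul']
    rw [this, map_smul, map_smul, h]
  | add x y hx hy => rw [map_add, map_add, hx, hy]

/-- Unitality can be checked over the base. -/
theorem TensorAction.one_of_base (τ : A.TensorAction N)
    (h : ∀ m : N, τ.app (CommAlgCat.of R R) 1 (1 ⊗ₜ m) = 1 ⊗ₜ m) (T : CommAlgCat.{u} R) :
    τ.app T 1 = 1 := by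
  refine end_ext fun m => ?_
  have := τ.naturality (fromBase T) 1 (1 ⊗ₜ m)
  rw [h, map_one, tensorMap_one_tmul] at this
  exact this.symm

/-- Over an essentially free algebra, associativity can be checked over the base. -/
theorem TensorAction.mul_of_base (K : A.toModFunctor.Coordinates) (τ : A.TensorAction N)
    (h : ∀ (a b : A.obj (CommAlgCat.of R R)) (m : N), τ.app (CommAlgCat.of R R) (a * b) (1 ⊗ₜ m) =
      τ.app (CommAlgCat.of R R) a (τ.app (CommAlgCat.of R R) b (1 ⊗ₜ m)))
    (T : CommAlgCat.{u} R) (a b : A.obj T) : τ.app T (a * b) = τ.app T a * τ.app T b := by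
  refine end_ext fun m => sub_eq_zero.1 ?_
  have hid : A.map (𝟙 T) b = b := A.map_id T b
  -- With `b` fixed, the defect is linear in `a`, so `a` may be taken to be a basis vector.
  have key := K.app_eq_zero (τ.assocDefectLeft b (1 ⊗ₜ m)) (fun i => ?_) (𝟙 T) a
  · change τ.app T (a * A.map (𝟙 T) b) (tensorMap N (𝟙 T) (1 ⊗ₜ m)) -
      τ.app T a (τ.app T (A.map (𝟙 T) b) (tensorMap N (𝟙 T) (1 ⊗ₜ m))) = 0 at key
    rwa [hid, tensorMap_id] at key
  · let e : A.obj (CommAlgCat.of R R) := K.basisVec (CommAlgCat.of R R) i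
    let e₁ : A.obj T := K.basisVec T i
    have he : e₁ = A.map (fromBase T) e := (K.map_basisVec (fromBase T) i).symm
    change τ.app T (e₁ * A.map (𝟙 T) b) (tensorMap N (𝟙 T) (1 ⊗ₜ m)) -
      τ.app T e₁ (τ.app T (A.map (𝟙 T) b) (tensorMap N (𝟙 T) (1 ⊗ₜ m))) = 0
    rw [hid, tensorMap_id, he]
    -- Now `e` and `1 ⊗ m` both live over `R`, so the defect in `b` is a family over `R` and only
    -- basis vectors of `𝔸(R)` remain to be checked.
    have key := K.app_eq_zero (τ.assocDefectRight e (1 ⊗ₜ m)) (fun j => ?_) (fromBase T) b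
    · change τ.app T (A.map (fromBase T) e * b) (tensorMap N (fromBase T) (1 ⊗ₜ m)) -
        τ.app T (A.map (fromBase T) e) (τ.app T b (tensorMap N (fromBase T) (1 ⊗ₜ m))) = 0 at key
      rwa [tensorMap_one_tmul] at key
    · let e' : A.obj (CommAlgCat.of R R) := K.basisVec (CommAlgCat.of R R) j
      change τ.app _ (A.map (𝟙 _) e * e') (tensorMap N (𝟙 _) (1 ⊗ₜ m)) -
        τ.app _ (A.map (𝟙 _) e) (τ.app _ e' (tensorMap N (𝟙 _) (1 ⊗ₜ m))) = 0
      rw [tensorMap_id, A.map_id]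
      exact sub_eq_zero.2 (h e e' m)

end Tensor

end AlgFunctor
end

noncomputable section

/-! ### Restricting the action to a stable submodule. -/

namespace AlgFunctor

open ModFunctor

variable {R : Type u} [CommRing R] {A : AlgFunctor R} {M : Type u} [AddCommGroup M] [Module R M]

namespace TensorAction

/-- The action of `𝔸(R)` on `M = R ⊗ M`. -/
def base (σ : A.TensorAction M) (a : A.obj (CommAlgCat.of R R)) : M →ₗ[R] M :=
  (TensorProduct.lid R M).toLinearMap ∘ₗ
    (show (R ⊗[R] M) →ₗ[R] (R ⊗[R] M) from σ.app (CommAlgCat.of R R) a) ∘ₗ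
      (TensorProduct.lid R M).symm.toLinearMap

theorem app_one_tmul (σ : A.TensorAction M) (a : A.obj (CommAlgCat.of R R)) (m : M) :
    σ.app (CommAlgCat.of R R) a ((1 : R) ⊗ₜ m) = (1 : R) ⊗ₜ σ.base a m :=
  ((TensorProduct.lid R M).symm_apply_apply _).symm

section Restrict

variable (K : A.toModFunctor.Coordinates) (σ : A.TensorAction M) (M' : Submodule R M)
  (h : ∀ (a : A.obj (CommAlgCat.of R R)), ∀ m ∈ M', σ.base a m ∈ M')

/-- The coordinates of an element of `𝔸(T)`. -/
def coord (T : CommAlgCat.{u} R) : A.obj T →ₗ[T] (K.I → T) := K.coord T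

theorem coord_map {T U : CommAlgCat.{u} R} (g : T ⟶ U) (a : A.obj T) (i : K.I) :
    coord K U (A.map g a) i = g.hom (coord K T a i) :=
  K.coord_map g a i

/-- The action of a basis vector on a submodule `M'` stable under `𝔸(R)`. -/
def basisEnd (i : K.I) : M' →ₗ[R] M' :=
  (σ.base (K.basisVec (CommAlgCat.of R R) i)).restrict fun m hm => h _ m hm

/-- Finiteness comes from the orbit map of `1 ⊗ m` in `𝓜` over `R`: only finitely many `eᵢ` with `i`
in the support of `a` move `m` to a nonzero element. -/
theorem hasFiniteSupport_coord_tmul {T : CommAlgCat.{u} R} (a : A.obj T) (m : M') :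
    Function.HasFiniteSupport fun i => coord K T a i ⊗ₜ[R] basisEnd K σ M' h i m := by
  refine (K.finite_setOf_app_basisVec_ne_zero
    (σ.orbit (S := CommAlgCat.of R R) ((1 : R) ⊗ₜ (m : M))) _
    (K.support_mem T a)).subset fun i hi => ⟨fun h0 => hi ?_, fun h0 => hi ?_⟩
  · change coord K T a i = 0 at h0
    simp only [h0, TensorProduct.zero_tmul]
  · change σ.app (CommAlgCat.of R R) (K.basisVec (CommAlgCat.of R R) i)
      (tensorMap M (𝟙 (CommAlgCat.of R R)) ((1 : R) ⊗ₜ (m : M))) = 0 at h0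
    rw [tensorMap_id] at h0
    have h1 : σ.base (K.basisVec (CommAlgCat.of R R) i) (m : M) = 0 := by
      simpa using congrArg (TensorProduct.lid R M) ((σ.app_one_tmul _ _).symm.trans h0)
    -- Vanishing passes from `M` to `M'` before tensoring with `T`, where injectivity is still
    -- available.
    have h2 : basisEnd K σ M' h i m = 0 := Subtype.ext h1
    simp only [h2, TensorProduct.tmul_zero]

/-- The map `m ↦ ∑ᵢ aᵢ ⊗ eᵢ m`. -/
def restrictAux (T : CommAlgCat.{u} R) : A.obj T →ₗ[T] (M' →ₗ[R] T ⊗[R] M') where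
  toFun a :=
    { toFun := fun m => ∑ᶠ i, coord K T a i ⊗ₜ[R] basisEnd K σ M' h i m
      map_add' := fun m m' => by
        rw [← finsum_add_distrib (hasFiniteSupport_coord_tmul ..)
          (hasFiniteSupport_coord_tmul ..)]
        simp [TensorProduct.tmul_add]
      map_smul' := fun r m => by
        rw [RingHom.id_apply, smul_finsum' _ (hasFiniteSupport_coord_tmul ..)]
        simp }
  map_add' a b := by
    ext m
    refine Eq.trans ?_ (finsum_add_distrib (hasFiniteSupport_coord_tmul K σ M' h a m)
      (hasFiniteSupport_coord_tmul K σ M' h b m))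
    simp [TensorProduct.add_tmul]
  map_smul' t a := by
    ext m
    refine Eq.trans ?_ (smul_finsum' t (hasFiniteSupport_coord_tmul K σ M' h a m)).symm
    simp [TensorProduct.smul_tmul']

theorem restrictAux_apply {T : CommAlgCat.{u} R} (a : A.obj T) (m : M') :
    restrictAux K σ M' h T a m = ∑ᶠ i, coord K T a i ⊗ₜ[R] basisEnd K σ M' h i m :=
  rfl

theorem tensorMap_restrictAux {T U : CommAlgCat.{u} R} (g : T ⟶ U) (a : A.obj T) (m : M') :
    tensorMap M' g (restrictAux K σ M' h T a m) = restrictAux K σ M' h U (A.map g a) m := by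
  rw [restrictAux_apply, restrictAux_apply, map_finsum _ (hasFiniteSupport_coord_tmul ..)]
  simp [coord_map]

/-- Both sides are `∑ᵢ aᵢ ⊗ eᵢ m` in `T ⊗ M`: the right one by expanding the orbit map of `1 ⊗ m`.
-/
theorem baseChange_subtype_restrictAux {T : CommAlgCat.{u} R} (a : A.obj T) (m : M') :
    M'.subtype.baseChange T (restrictAux K σ M' h T a m) = σ.app T a (1 ⊗ₜ (m : M)) := by
  have key := K.app_eq_finsum (σ.orbit (S := CommAlgCat.of R R) ((1 : R) ⊗ₜ (m : M)))
    (fromBase T) a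
  have h1 : σ.app T a (1 ⊗ₜ (m : M)) =
      (σ.orbit (S := CommAlgCat.of R R) ((1 : R) ⊗ₜ (m : M))).app (fromBase T) a :=
    congrArg (σ.app T a) (tensorMap_one_tmul (fromBase T) (m : M)).symm
  rw [h1, key, restrictAux_apply, map_finsum _ (hasFiniteSupport_coord_tmul ..)]
  refine finsum_congr fun i => ?_
  have h2 : (σ.orbit (S := CommAlgCat.of R R) ((1 : R) ⊗ₜ (m : M))).app (𝟙 _)
      (K.basisVec _ i) = (1 : R) ⊗ₜ (basisEnd K σ M' h i m : M) := by
    refine Eq.trans ?_ (σ.app_one_tmul _ _)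
    exact congrArg (σ.app (CommAlgCat.of R R) (K.basisVec _ i)) (tensorMap_id _)
  rw [h2]
  refine Eq.trans ?_ (congrArg (K.coord T a i • ·)
    (tensorMap_one_tmul (fromBase T) (basisEnd K σ M' h i m : M))).symm
  rw [TensorProduct.smul_tmul', smul_eq_mul, mul_one, LinearMap.baseChange_tmul]
  rfl

/-- The natural bilinear maps on a submodule stable under `𝔸(R)`. -/
def restrict : A.TensorAction M' where
  app T := (LinearMap.liftBaseChangeEquiv T).toLinearMap ∘ₗ restrictAux K σ M' h T
  naturality {T U} g a y := by
    change tensorMap M' g ((restrictAux K σ M' h T a).liftBaseChange T y) =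
      (restrictAux K σ M' h U (A.map g a)).liftBaseChange U (tensorMap M' g y)
    induction y using TensorProduct.induction_on with
    | zero => simp
    | tmul t m =>
      rw [LinearMap.liftBaseChange_tmul, tensorMap_smul, tensorMap_restrictAux,
        LinearMap.rTensor_tmul, LinearMap.liftBaseChange_tmul]
      rfl
    | add x y hx hy => simp only [map_add, hx, hy]

theorem baseChange_subtype_restrict {T : CommAlgCat.{u} R} (a : A.obj T) (y : T ⊗[R] M') :
    M'.subtype.baseChange T ((restrict K σ M' h).app T a y) =
      σ.app T a (M'.subtype.baseChange T y) := by
  have : M'.subtype.baseChange T ∘ₗ (restrict K σ M' h).app T a =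
      (σ.app T a) ∘ₗ M'.subtype.baseChange T := by
    refine end_ext fun m => ?_
    refine Eq.trans (congrArg (M'.subtype.baseChange T)
      (LinearMap.liftBaseChange_one_tmul T (restrictAux K σ M' h T a) m)) ?_
    rw [baseChange_subtype_restrictAux, LinearMap.comp_apply, LinearMap.baseChange_tmul]
    rfl
  exact LinearMap.congr_fun this y

end Restrict

end TensorAction

/-- `R` is flat over itself. This is what lets the unit law and associativity descend from `M` to
`M'` over the base. -/
theorem baseChange_subtype_injective (M' : Submodule R M) :
    Function.Injective (M'.subtype.baseChange (CommAlgCat.of R R)) :=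
  Module.Flat.lTensor_preserves_injective_linearMap (M := R) M'.subtype M'.injective_subtype

theorem isBaseSubmodule_iff (s : A.ModuleStr (quasiCoherent (R := R) M)) (M' : Submodule R M) :
    IsBaseSubmodule s M' ↔
      ∀ (a : A.obj (CommAlgCat.of R R)), ∀ m ∈ M', s.toTensorAction.base a m ∈ M' := by
  constructor
  · rintro ⟨N, hN⟩ a m hm
    have hm' : m ∈ (N : Set M) := hN ▸ hm
    have := @Submodule.smul_mem _ _ _ _ (_) N m a hm'
    have h2 : s.toTensorAction.base a m ∈ (N : Set M) := this
    rwa [hN] at h2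
  · intro h
    let _ := baseModule s
    exact ⟨{ carrier := M'
             add_mem' := M'.add_mem
             zero_mem' := M'.zero_mem
             smul_mem' := fun a m hm => h a m hm }, rfl⟩

end AlgFunctor

end

theorem mainTheorem8 {R : Type u} [CommRing R] (A : AlgFunctor R)
    (hA : A.toModFunctor.EssentiallyFree)
    (M : Type u) [AddCommGroup M] [Module R M]
    (s : A.ModuleStr (ModFunctor.quasiCoherent (R := R) M)) (M' : Submodule R M) :
    AlgFunctor.IsQuasiCoherentSubmodule s M' ↔ AlgFunctor.IsBaseSubmodule s M' := by
  rw [AlgFunctor.isBaseSubmodule_iff]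
  constructor
  · rintro ⟨t, ht⟩ a m hm
    have h1 := ht (CommAlgCat.of R R) a ((1 : R) ⊗ₜ (⟨m, hm⟩ : M'))
    change M'.subtype.baseChange (CommAlgCat.of R R) (t.toTensorAction.app (CommAlgCat.of R R) a
      ((1 : R) ⊗ₜ (⟨m, hm⟩ : M'))) = s.toTensorAction.app (CommAlgCat.of R R) a
      (M'.subtype.baseChange (CommAlgCat.of R R) ((1 : R) ⊗ₜ (⟨m, hm⟩ : M'))) at h1
    rw [AlgFunctor.TensorAction.app_one_tmul, LinearMap.baseChange_tmul, LinearMap.baseChange_tmul] at h1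
    have h2 := h1.trans (s.toTensorAction.app_one_tmul a m)
    have h3 := congrArg (TensorProduct.lid R M) h2
    rw [TensorProduct.lid_tmul, TensorProduct.lid_tmul, one_smul, one_smul] at h3
    rw [← h3]
    exact Subtype.property _
  · intro h
    obtain ⟨K⟩ := hA.nonempty_coordinates
    let τ := s.toTensorAction.restrict K M' h
    have hτ : ∀ (T : CommAlgCat.{u} R) (a : A.obj T) (y : T ⊗[R] M'),
        M'.subtype.baseChange T (τ.app T a y) = s.toTensorAction.app T a
          (M'.subtype.baseChange T y) := fun T a y =>
      s.toTensorAction.baseChange_subtype_restrict K M' h a y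
    -- Over `R`, the identity can be tested after the injective map into `R ⊗ M`, where it holds by
    -- the given module structure; the same argument gives associativity.
    have one : ∀ T, τ.app T 1 = 1 := τ.one_of_base fun m => by
      refine AlgFunctor.baseChange_subtype_injective M' ?_
      rw [hτ]
      exact LinearMap.congr_fun (s.toTensorAction_one _) _
    have mul : ∀ T a b, τ.app T (a * b) = τ.app T a * τ.app T b :=
      τ.mul_of_base K fun a b m => by
        refine AlgFunctor.baseChange_subtype_injective M' ?_
        rw [hτ, hτ, hτ]
        exact LinearMap.congr_fun (s.toTensorAction_mul _ a b) _
    exact ⟨τ.toModuleStr one mul, hτ⟩
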